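/- Let $G=(V,E)$ be a finite simple triangle-free graph with maximum degree at most $3$, and let $w:E\to\mathbb{R}_{\ge 0}$ be a weight function on its edges. For a subgraph $H$ of $G$ write $w(H)=\sum_{e\in E(H)}w(e)$, and let $\mathrm{mac}(G)$ denote the maximum of $\sum_{e\in E(A,V\setminus A)}w(e)$ over all $A\subseteq V$, where $E(A,V\setminus A)$ is the set of edges with one end in $A$ and the other in $V\setminus A$. Then $$\mathrm{mac}(G)\ \ge\ \tfrac{8}{11}\,w(G).$$ -/

import Mathlib

namespace WeightedCut

open Classical in
/-- The total weight `w(H) = ∑_{e ∈ E(H)} w(e)` of a graph `H` on the finite vertex set `V`.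
Only the values of `w` on edges of `H` matter. -/
noncomputable def weight {V : Type*} [Fintype V] (H : SimpleGraph V) (w : Sym2 V → ℝ) : ℝ :=
  ∑ e ∈ H.edgeFinset, w e

/-- The cut `(A, V \ A)` of `G`: the bipartite subgraph formed by the edges of `G` with one end
in `A` and the other end outside `A`. -/
def cut {V : Type*} (G : SimpleGraph V) (A : Finset V) : SimpleGraph V :=
  G.between (A : Set V) (A : Set V)ᶜ

/-- The maximum weight `mac(G)` of a cut of `G`. -/
noncomputable def mac {V : Type*} [Fintype V] (G : SimpleGraph V) (w : Sym2 V → ℝ) : ℝ :=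
  (Finset.univ : Finset (Finset V)).sup' Finset.univ_nonempty (fun A => weight (cut G A) w)

end WeightedCut

namespace WeightedCut

open Finset

/-! By Brooks, `G` has a proper 3-colouring. Of the two colours a vertex lacks, one occurs at most
once among its at most three neighbours; let the vertex point to it. An edge whose ends have equal
directions is then an arc one way; otherwise its ends point to each other or neither points to the
other.

Three kinds of cut are averaged. One splits `V` by direction. Three come from `cutSide`, one for
each colour `k`. Three are random: dropping the arcs out of colour `k` leaves parts that are single
edges or trees of depth at most two, and as `G` is triangle-free these parts induce bipartite graphs
(`side_ne_of_root_eq`); flipping the parts independently cuts every inner edge and half of the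
remaining weight (`sum_partition_le_mac`).

With weights 1, 3 and 4 per cut, the total is 1 + 9 + 12 = 22, and every edge is cut with total
weight at least 16; 16/22 = 8/11. -/

theorem isChain_adj_reverse {V : Type*} {G : SimpleGraph V} {l : List V} (h : l.IsChain G.Adj) : l.reverse.IsChain G.Adj :=
  List.isChain_reverse.2 (h.imp fun _ _ h => h.symm)

/-! ### Brooks' theorem for three colours. -/

section Brooks

variable {V : Type*} [DecidableEq V] {G : SimpleGraph V}

/-- `c` restricts to a proper colouring of the subgraph of `G` induced by `T`. -/
def ProperOn {α : Type*} (G : SimpleGraph V) (c : V → α) (T : Finset V) : Prop :=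
  ∀ u ∈ T, ∀ v ∈ T, G.Adj u v → c u ≠ c v

theorem ProperOn.update_insert {α : Type*} {c : V → α} {T : Finset V} (hc : ProperOn G c T)
    {v : V} (hv : v ∉ T) {a : α} (ha : ∀ u ∈ T, G.Adj v u → c u ≠ a) :
    ProperOn G (Function.update c v a) (insert v T) := by
  intro x hx y hy hxy
  rw [mem_insert] at hx hy
  rcases hx with rfl | hx <;> rcases hy with rfl | hy
  · exact absurd hxy (G.irrefl)
  · have : y ≠ x := fun h => hv (h ▸ hy)
    simpa [this] using (ha y hy hxy).symm
  · have : x ≠ y := fun h => hv (h ▸ hx)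
    simpa [this] using ha x hx hxy.symm
  · have h1 : x ≠ v := fun h => hv (h ▸ hx)
    have h2 : y ≠ v := fun h => hv (h ▸ hy)
    simpa [h1, h2] using hc x hx y hy hxy

/-- Counting colours instead of neighbours covers both uses: an uncoloured neighbour remains, or two
of three neighbours agree. -/
theorem ProperOn.exists_insert {c : V → ZMod 3} {T : Finset V} (hc : ProperOn G c T)
    {v : V} (hv : v ∉ T) {N : Finset V} (hN : ∀ u ∈ T, G.Adj v u → u ∈ N)
    (hcard : (N.image c).card ≤ 2) :
    ∃ c' : V → ZMod 3, ProperOn G c' (insert v T) ∧ ∀ u ∈ T, c' u = c u := by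
  obtain ⟨a, ha⟩ : ∃ a, a ∉ N.image c := by
    by_contra! h
    have : N.image c = univ := eq_univ_iff_forall.2 h
    rw [this] at hcard
    simp [ZMod.card] at hcard
  refine ⟨_, hc.update_insert hv (a := a) fun u hu huv h =>
    ha (mem_image.2 ⟨u, hN u hu huv, h⟩), fun u hu => ?_⟩
  have : u ≠ v := fun h => hv (h ▸ hu)
  simp [this]

/-- Greedy colouring along a path whose last vertex `b` stays uncoloured. -/
theorem ProperOn.exists_extend_path {N : V → Finset V} (hN : ∀ v u, G.Adj v u → u ∈ N v)
    (hdeg : ∀ v, (N v).card ≤ 3) (b : V) (l : List V) {c : V → ZMod 3} {T : Finset V}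
    (hc : ProperOn G c T) (hchain : (l ++ [b]).IsChain G.Adj) (hnd : (l ++ [b]).Nodup)
    (hdisj : ∀ x ∈ l ++ [b], x ∉ T) :
    ∃ c' : V → ZMod 3, ProperOn G c' (T ∪ l.toFinset) ∧ ∀ u ∈ T, c' u = c u := by
  induction l generalizing c T with
  | nil => exact ⟨c, by simpa using hc, fun _ _ => rfl⟩
  | cons a l ih =>
    -- The next vertex `d` of the path is still uncoloured, so `a` has at most two coloured
    -- neighbours.
    obtain ⟨d, hd, hda, hdl⟩ : ∃ d, d ∉ T ∧ G.Adj a d ∧ d ∈ l ++ [b] := by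
      cases l with
      | nil => exact ⟨b, hdisj b (by simp), by simpa using hchain, by simp⟩
      | cons d l => exact ⟨d, hdisj d (by simp), by simp at hchain; exact hchain.1, by simp⟩
    have haT : a ∉ T := hdisj a (by simp)
    obtain ⟨c₁, hc₁, hcc₁⟩ := hc.exists_insert haT (N := (N a).erase d)
      (fun u hu hau => mem_erase.2 ⟨fun h => hd (h ▸ hu), hN _ _ hau⟩) (by
        refine card_image_le.trans ?_
        rw [card_erase_of_mem (hN _ _ hda)]
        have := hdeg a
        omega)
    rw [List.cons_append, List.nodup_cons] at hnd
    obtain ⟨c₂, hc₂, hcc₂⟩ := ih hc₁ (List.IsChain.of_cons hchain) hnd.2 (fun x hx => by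
      rw [mem_insert, not_or]
      exact ⟨fun h => hnd.1 (h ▸ hx), hdisj x (List.mem_cons_of_mem _ hx)⟩)
    refine ⟨c₂, ?_, fun u hu => (hcc₂ u (mem_insert_of_mem hu)).trans (hcc₁ u hu)⟩
    convert hc₂ using 1
    ext x
    simp

theorem exists_last_of_exists {α : Type*} (P : α → Prop) (l : List α) (h : ∃ x ∈ l, P x) :
    ∃ p z s, l = p ++ z :: s ∧ P z ∧ ∀ x ∈ s, ¬ P x := by
  induction l with
  | nil => simp at h
  | cons a l ih =>
    by_cases h' : ∃ x ∈ l, P x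
    · obtain ⟨p, z, s, rfl, hz, hs⟩ := ih h'
      exact ⟨a :: p, z, s, rfl, hz, hs⟩
    · push Not at h'
      obtain ⟨x, hx, hPx⟩ := h
      rcases List.mem_cons.1 hx with rfl | hx
      · exact ⟨[], x, l, rfl, hPx, h'⟩
      · exact absurd hPx (h' x hx)

theorem exists_first_of_exists {α : Type*} (P : α → Prop) (l : List α) (h : ∃ x ∈ l, P x) :
    ∃ p z s, l = p ++ z :: s ∧ P z ∧ ∀ x ∈ p, ¬ P x := by
  obtain ⟨p, z, s, h₁, h₂, h₃⟩ := exists_last_of_exists P l.reverse (by simpa using h)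
  refine ⟨s.reverse, z, p.reverse, ?_, h₂, by simpa using h₃⟩
  have := congrArg List.reverse h₁
  simpa using this

/-- A nonempty finite set in which every vertex has three neighbours contains a cycle through
some vertex `v` and all its neighbours inside the set. -/
theorem exists_cycle_through_neighbors {N : V → Finset V} (hN : ∀ v u, u ∈ N v ↔ G.Adj v u)
    (S : Finset V) (hS : S.Nonempty) (hne : ∀ v ∈ S, (S ∩ N v).Nonempty) :
    ∃ (v : V) (p : List V) (z : V), (v :: p ++ [z]).IsChain G.Adj ∧ (v :: p ++ [z]).Nodup ∧
      (∀ x ∈ v :: p ++ [z], x ∈ S) ∧ G.Adj v z ∧ ∀ u ∈ S, G.Adj v u → u ∈ p ++ [z] := by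
  -- On a longest path in `S`, all neighbours in `S` of the first vertex lie on the path; cutting it
  -- after the last of them closes the cycle.
  let Q : ℕ → Prop := fun n =>
    ∃ l : List V, l.length = n ∧ l.IsChain G.Adj ∧ l.Nodup ∧ ∀ x ∈ l, x ∈ S
  have hbound : ∀ n, Q n → n ≤ S.card := by
    rintro n ⟨l, rfl, -, hnd, hl⟩
    rw [← List.toFinset_card_of_nodup hnd]
    exact card_le_card fun x hx => hl x (List.mem_toFinset.1 hx)
  classical
  obtain ⟨s, hs⟩ := hS
  have h1 : Q 1 := ⟨[s], rfl, by simp, by simp, by simpa using hs⟩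
  have hmax := Nat.findGreatest_spec (P := Q) (hbound 1 h1) h1
  have hpos : 1 ≤ Nat.findGreatest Q S.card := Nat.le_findGreatest (hbound 1 h1) h1
  obtain ⟨l, hlen, hch, hnd, hl⟩ := hmax
  cases l with
  | nil => simp at hlen; omega
  | cons v l =>
    have hvS : v ∈ S := hl v (by simp)
    have hnbr : ∀ u ∈ S, G.Adj v u → u ∈ l := by
      intro u hu hvu
      by_contra hul
      have : Q (l.length + 2) := by
        refine ⟨u :: v :: l, rfl, ?_, ?_, ?_⟩
        · exact List.IsChain.cons_cons hvu.symm hch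
        · refine List.nodup_cons.2 ⟨?_, hnd⟩
          simp only [List.mem_cons, not_or]
          exact ⟨hvu.ne', hul⟩
        · intro x hx
          rcases List.mem_cons.1 hx with rfl | hx
          exacts [hu, hl x hx]
      have := Nat.le_findGreatest (hbound _ this) this
      simp at hlen
      omega
    obtain ⟨u, hu⟩ := hne v hvS
    rw [mem_inter, hN] at hu
    obtain ⟨p, z, t, rfl, hz, ht⟩ := exists_last_of_exists (G.Adj v) l ⟨u, hnbr u hu.1 hu.2, hu.2⟩
    have hpre : (v :: p ++ [z]) <+: (v :: (p ++ z :: t)) := ⟨t, by simp⟩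
    refine ⟨v, p, z, hch.prefix hpre, hnd.sublist hpre.sublist, fun x hx => hl x (hpre.subset hx),
      hz, fun x hx hvx => ?_⟩
    have := hnbr x hx hvx
    simp only [List.mem_append, List.mem_cons] at this ⊢
    rcases this with h | h | h
    · exact Or.inl h
    · simp [h]
    · exact absurd hvx (ht x h)

theorem card_image_le_two_of_card_le_three {c : V → ZMod 3} {N : Finset V} (hN : N.card ≤ 3)
    {a b : V} (ha : a ∈ N) (hb : b ∈ N) (hab : a ≠ b) (h : c a = c b) : (N.image c).card ≤ 2 := by
  have : N.image c = (N.erase a).image c := by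
    ext x
    simp only [mem_image, mem_erase]
    constructor
    · rintro ⟨y, hy, rfl⟩
      by_cases hya : y = a
      · exact ⟨b, ⟨hab.symm, hb⟩, by rw [hya, h]⟩
      · exact ⟨y, ⟨hya, hy⟩, rfl⟩
    · rintro ⟨y, ⟨-, hy⟩, rfl⟩
      exact ⟨y, hy, rfl⟩
  rw [this]
  refine card_image_le.trans ?_
  rw [card_erase_of_mem ha]
  omega

/-- A proper colouring of the complement of a cycle extends to the cycle, provided that the
cycle has consecutive vertices `a`, `b` such that `b` has a coloured neighbour and `a` has none. -/
theorem ProperOn.exists_extend_cycle {N : V → Finset V} (hN : ∀ v u, G.Adj v u → u ∈ N v)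
    (hdeg : ∀ v, (N v).card ≤ 3) {T : Finset V} {c : V → ZMod 3} (hc : ProperOn G c T)
    {a b : V} {l : List V} (hch : (a :: (l ++ [b])).IsChain G.Adj)
    (hnd : (a :: (l ++ [b])).Nodup) (hdisj : ∀ x ∈ a :: (l ++ [b]), x ∉ T) (hab : G.Adj a b)
    (ha : ∀ y ∈ T, ¬ G.Adj a y) {x : V} (hx : x ∈ T) (hbx : G.Adj b x) :
    ∃ c' : V → ZMod 3, ProperOn G c' (T ∪ (a :: (l ++ [b])).toFinset) := by
  have haT : a ∉ T := hdisj a (by simp)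
  -- With `a` coloured like `x`, the last vertex `b` has two neighbours of one colour.
  have h₁ := hc.update_insert haT (a := c x) (fun u hu hau => absurd hau (ha u hu))
  rw [List.nodup_cons] at hnd
  obtain ⟨c₂, hc₂, hcc₂⟩ := h₁.exists_extend_path hN hdeg b l (List.IsChain.of_cons hch) hnd.2
    (fun y hy => by
      rw [mem_insert, not_or]
      exact ⟨fun h => hnd.1 (h ▸ hy), hdisj y (List.mem_cons_of_mem _ hy)⟩)
  have hxa : x ≠ a := fun h => haT (h ▸ hx)
  have hca : c₂ a = c₂ x := by
    rw [hcc₂ a (mem_insert_self _ _), hcc₂ x (mem_insert_of_mem hx)]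
    simp [hxa]
  have hbT : b ∉ insert a T ∪ l.toFinset := by
    have := (List.nodup_append.1 hnd.2).2.2
    simp only [mem_union, mem_insert, List.mem_toFinset, not_or]
    exact ⟨⟨hab.ne', hdisj b (by simp)⟩, fun h => this b h b (by simp) rfl⟩
  obtain ⟨c₃, hc₃, -⟩ := hc₂.exists_insert hbT (N := N b) (fun u _ h => hN _ _ h)
    (card_image_le_two_of_card_le_three (hdeg b) (hN _ _ hab.symm) (hN _ _ hbx) hxa.symm hca)
  refine ⟨c₃, ?_⟩
  convert hc₃ using 1
  ext y
  simp only [mem_union, mem_insert, List.mem_toFinset, List.mem_append, List.mem_cons,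
    List.not_mem_nil, or_false]
  tauto

/-- A cycle with a chord `v y` such that the neighbours `w`, `z` of `v` on the cycle are not
adjacent is 3-colourable. -/
theorem exists_properOn_cycle_with_chord {N : V → Finset V} (hN : ∀ v u, G.Adj v u → u ∈ N v)
    (hdeg : ∀ v, (N v).card ≤ 3) {v w y z : V} {m₁ m₂ : List V}
    (hch : (v :: w :: (m₁ ++ y :: m₂) ++ [z]).IsChain G.Adj)
    (hnd : (v :: w :: (m₁ ++ y :: m₂) ++ [z]).Nodup) (hvy : G.Adj v y) (hvz : G.Adj v z)
    (hwz' : ¬ G.Adj w z) :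
    ∃ c : V → ZMod 3, ProperOn G c (v :: w :: (m₁ ++ y :: m₂) ++ [z]).toFinset := by
  have hvw : G.Adj v w := by simp at hch; exact hch.1
  have hl1 : (m₁ ++ [y]) <:+: (v :: w :: (m₁ ++ y :: m₂) ++ [z]) :=
    ⟨[v, w], m₂ ++ [z], by simp⟩
  have hl2 : (y :: m₂) <:+: (v :: w :: (m₁ ++ y :: m₂) ++ [z]) := ⟨v :: w :: m₁, [z], by simp⟩
  have hnd' := hnd
  simp only [List.cons_append, List.append_assoc, List.nodup_cons, List.nodup_append,
    List.mem_cons, List.mem_append, List.not_mem_nil, or_false, not_or, List.nodup_nil] at hnd'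
  obtain ⟨⟨hvw', hv1, hvy', hv2, hvz'⟩, ⟨hw1, hwy, hw2, hwz⟩, -, ⟨⟨hy2, hyz⟩, -, -, h2z⟩, h1⟩ :=
    hnd'
  have h₀ : ProperOn G (fun _ => (0 : ZMod 3)) {w, z} := by
    intro s hs t ht hst
    simp only [mem_insert, mem_singleton] at hs ht
    rcases hs with rfl | rfl <;> rcases ht with rfl | rfl
    · exact absurd hst G.irrefl
    · exact absurd hst hwz'
    · exact absurd hst.symm hwz'
    · exact absurd hst G.irrefl
  -- With `w` and `z` alike, colour `m₁` towards `y`, then `m₂` backwards and `y`, whose chord leads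
  -- to the uncoloured `v`. Finally `v` sees a repeated colour.
  obtain ⟨c₁, hc₁, hcc₁⟩ := h₀.exists_extend_path hN hdeg y m₁ (hch.infix hl1)
    (hnd.sublist hl1.sublist) (fun x hx => by
      simp only [mem_insert, mem_singleton, List.mem_append, List.not_mem_nil, or_false,
        List.mem_cons] at hx ⊢
      grind)
  obtain ⟨c₂, hc₂, hcc₂⟩ := hc₁.exists_extend_path hN hdeg v (m₂.reverse ++ [y]) (by
      simpa using isChain_adj_reverse (List.IsChain.cons_cons hvy (hch.infix hl2))) (by
      have : (v :: y :: m₂).Nodup :=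
        List.nodup_cons.2 ⟨by simp [hvy', hv2], hnd.sublist hl2.sublist⟩
      simpa using List.nodup_reverse.2 this) (fun x hx => by
      simp only [mem_insert, mem_singleton, List.mem_append, List.not_mem_nil, or_false,
        List.mem_cons, List.mem_reverse, mem_union, List.mem_toFinset] at hx ⊢
      grind)
  have hcwz : c₂ w = c₂ z := by
    rw [hcc₂ w (by simp), hcc₂ z (by simp), hcc₁ w (by simp), hcc₁ z (by simp)]
  obtain ⟨c₃, hc₃, -⟩ := hc₂.exists_insert (v := v) (by simp [*]) (N := N v) (fun u _ h => hN _ _ h)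
    (card_image_le_two_of_card_le_three (hdeg v) (hN _ _ hvw) (hN _ _ hvz) hwz hcwz)
  refine ⟨c₃, ?_⟩
  convert hc₃ using 1
  ext x
  simp only [mem_union, mem_insert, List.mem_toFinset, List.mem_append, List.mem_cons,
    List.mem_reverse, List.not_mem_nil, or_false, mem_singleton]
  tauto

/-- Brooks' theorem for triangle-free graphs of maximum degree at most three. -/
theorem exists_properOn {N : V → Finset V} (hN : ∀ v u, u ∈ N v ↔ G.Adj v u)
    (hdeg : ∀ v, (N v).card ≤ 3) (htri : ∀ u v x, G.Adj u v → G.Adj v x → ¬ G.Adj u x)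
    (S : Finset V) : ∃ c : V → ZMod 3, ProperOn G c S := by
  have hN' : ∀ v u, G.Adj v u → u ∈ N v := fun v u h => (hN v u).2 h
  induction S using Finset.strongInduction with
  | H S ih =>
  rcases S.eq_empty_or_nonempty with rfl | hne
  · exact ⟨0, by simp [ProperOn]⟩
  by_cases hlow : ∃ v ∈ S, (S ∩ N v).card ≤ 2
  · obtain ⟨v, hv, hcard⟩ := hlow
    obtain ⟨c, hc⟩ := ih (S.erase v) (erase_ssubset hv)
    obtain ⟨c', hc', -⟩ := hc.exists_insert (notMem_erase v S) (N := S ∩ N v)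
      (fun u hu huv => mem_inter.2 ⟨mem_of_mem_erase hu, hN' _ _ huv⟩) (card_image_le.trans hcard)
    rw [insert_erase hv] at hc'
    exact ⟨c', hc'⟩
  push Not at hlow
  obtain ⟨v, p, z, hch, hnd, hsub, hvz, hnbr⟩ := exists_cycle_through_neighbors hN S hne
    (fun v hv => card_pos.1 (by have := hlow v hv; omega))
  have hvS : v ∈ S := hsub v (by simp)
  set C : List V := v :: p ++ [z] with hC
  have hCS : C.toFinset ⊆ S := fun x hx => hsub x (List.mem_toFinset.1 hx)
  have hlt : S \ C.toFinset ⊂ S := by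
    refine ⟨sdiff_subset, fun h => ?_⟩
    have := h hvS
    simp [hC] at this
  by_cases hout : ∃ b ∈ C, ∃ x ∈ S \ C.toFinset, G.Adj b x
  · obtain ⟨c, hc⟩ := ih _ hlt
    obtain ⟨q, b, r, hqr, ⟨x, hx, hbx⟩, hq⟩ := exists_first_of_exists _ _ hout
    -- All neighbours of `v` in `S` are on the cycle, so `b` is not its head and has a predecessor
    -- `a` without outside neighbours.
    have hq0 : q ≠ [] := by
      rintro rfl
      rw [hC, List.nil_append, List.cons_append, List.cons.injEq] at hqr
      rw [mem_sdiff] at hx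
      refine hx.2 (List.mem_toFinset.2 ?_)
      have := hnbr x hx.1 (hqr.1 ▸ hbx)
      rw [hC, List.cons_append]
      exact List.mem_cons_of_mem _ this
    obtain ⟨q, a, rfl⟩ : ∃ q' a, q = q' ++ [a] := ⟨_, _, (List.dropLast_append_getLast hq0).symm⟩
    have haout : ∀ y ∈ S \ C.toFinset, ¬ G.Adj a y := by
      have := hq a (by simp)
      push Not at this
      exact this
    have haC : a ∈ C := by rw [hqr]; simp
    have hbC : b ∈ C := by rw [hqr]; simp
    have hab : G.Adj a b := by
      rw [hqr] at hch
      have := (List.isChain_append.1 hch).2.2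
      simpa using this
    have hvz' : ∀ y ∈ C.head?, ∀ y' ∈ C.getLast?, G.Adj y y' := by
      rw [hC]
      rintro y hy y' hy'
      rw [List.getLast?_concat, Option.mem_some_iff] at hy'
      rw [List.cons_append, List.head?_cons, Option.mem_some_iff] at hy
      exact hy ▸ hy' ▸ hvz
    rw [hqr] at hvz' hch
    have hl : a :: ((q.reverse ++ r.reverse) ++ [b]) = (q ++ [a]).reverse ++ (b :: r).reverse := by
      simp
    have hperm : ((q ++ [a]).reverse ++ (b :: r).reverse).Perm C := by
      rw [hqr]
      exact (List.reverse_perm _).append (List.reverse_perm _)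
    have h3 := List.isChain_append.1 hch
    obtain ⟨c', hc'⟩ := hc.exists_extend_cycle hN' hdeg (a := a) (b := b)
      (l := q.reverse ++ r.reverse) (by
        rw [hl, List.isChain_append]
        refine ⟨isChain_adj_reverse h3.1, isChain_adj_reverse h3.2.1, fun y hy y' hy' => ?_⟩
        rw [List.getLast?_reverse] at hy
        rw [List.head?_reverse] at hy'
        refine hvz' y ?_ y' ?_
        · rwa [List.head?_append_of_ne_nil _ hq0]
        · rwa [List.getLast?_append_of_ne_nil _ (by simp)])
      (by rw [hl]; exact hperm.nodup_iff.2 hnd)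
      (fun y hy => by
        rw [hl, hperm.mem_iff] at hy
        simp [hy]) hab haout hx hbx
    rw [hl, List.toFinset_eq_of_perm _ _ hperm, sdiff_union_of_subset hCS] at hc'
    exact ⟨c', hc'⟩
  push Not at hout
  rcases (S \ C.toFinset).eq_empty_or_nonempty with hemp | hnemp
  · have h3 : 2 < (S ∩ N v).card := hlow v hvS
    have hnd0 := hnd
    rw [hC, List.cons_append, List.nodup_cons] at hnd
    cases p with
    | nil =>
      have : S ∩ N v ⊆ {z} := fun x hx => by
        rw [mem_inter, hN] at hx
        simpa using hnbr x hx.1 hx.2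
      have := card_le_card this
      simp at this
      omega
    | cons w m =>
      have hvw : G.Adj v w := by simp [hC] at hch; exact hch.1
      obtain ⟨y, hy⟩ : ((S ∩ N v) \ {w, z}).Nonempty := by
        rw [← card_pos]
        have := le_card_sdiff {w, z} (S ∩ N v)
        have := card_le_two (a := w) (b := z)
        omega
      simp only [mem_sdiff, mem_inter, hN, mem_insert, mem_singleton, not_or] at hy
      have hym : y ∈ m := by
        have := hnbr y hy.1.1 hy.1.2
        simp only [List.cons_append, List.mem_cons, List.mem_append, List.not_mem_nil, or_false] at this
        tauto
      obtain ⟨m₁, m₂, rfl⟩ := List.append_of_mem hym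
      obtain ⟨c, hc⟩ := exists_properOn_cycle_with_chord hN' hdeg hch hnd0 hy.1.2 hvz
        (htri w v z hvw.symm hvz)
      exact ⟨c, by rwa [hCS.antisymm (sdiff_eq_empty_iff_subset.1 hemp)] at hc⟩
  · obtain ⟨c, hc⟩ := ih _ hlt
    obtain ⟨c', hc'⟩ := ih C.toFinset (by
      refine ⟨hCS, fun h => ?_⟩
      obtain ⟨x, hx⟩ := hnemp
      rw [mem_sdiff] at hx
      exact hx.2 (h hx.1))
    refine ⟨fun x => if x ∈ C then c' x else c x, fun s hs t ht hst => ?_⟩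
    by_cases h1 : s ∈ C <;> by_cases h2 : t ∈ C <;> simp only [h1, h2, if_true, if_false]
    · exact hc' s (by simpa) t (by simpa) hst
    · exact absurd hst (hout s h1 t (by simp [ht, h2]))
    · exact absurd hst.symm (hout t h2 s (by simp [hs, h1]))
    · exact hc s (by simp [hs, h1]) t (by simp [ht, h2]) hst

end Brooks

/-! ### Random cuts from bipartite parts. -/

section Cuts

variable {V : Type*} [Fintype V]

theorem weight_eq_sum {H G : SimpleGraph V} (hHG : H ≤ G) [DecidablePred (· ∈ H.edgeSet)]
    [Fintype G.edgeSet] (w : Sym2 V → ℝ) :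
    weight H w = ∑ e ∈ G.edgeFinset, if e ∈ H.edgeSet then w e else 0 := by
  classical
  rw [weight, ← sum_filter]
  refine sum_congr ?_ fun _ _ => rfl
  ext e
  simp only [SimpleGraph.mem_edgeFinset, mem_filter]
  exact ⟨fun h => ⟨SimpleGraph.edgeSet_mono hHG h, h⟩, fun h => h.2⟩

open Classical in
theorem sum_le_mac (G : SimpleGraph V) (w : Sym2 V → ℝ) (f : V → Bool) :
    (∑ e ∈ G.edgeFinset, w e * if (e.map f).IsDiag then 0 else 1) ≤ mac G w := by
  let A : Finset V := univ.filter fun v => f v = true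
  refine le_trans (le_of_eq ?_) (le_sup' (fun A => weight (cut G A) w) (mem_univ A))
  rw [weight_eq_sum (H := cut G A) (G := G) (SimpleGraph.between_le)]
  refine sum_congr rfl fun e he => ?_
  induction e with
  | h u v =>
    rw [SimpleGraph.mem_edgeFinset, SimpleGraph.mem_edgeSet] at he
    simp only [cut, SimpleGraph.mem_edgeSet, SimpleGraph.between_adj, he, Sym2.map_mk, Sym2.mk_isDiag_iff, A]
    cases h1 : f u <;> cases h2 : f v <;> simp [h1, h2]

-- Flipping `f` at `a` alone pairs each assignment separating the two ends with one that does not.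
open Classical in
theorem two_mul_card_flips {a b : V} (hab : a ≠ b) (s t : Bool) :
    2 * ∑ f : V → Bool, (if (s ^^ f a) = (t ^^ f b) then (0 : ℝ) else 1) =
      Fintype.card (V → Bool) := by
  let φ : (V → Bool) ≃ (V → Bool) := Function.Involutive.toPerm
    (fun f => Function.update f a (!f a)) (fun f => by simp)
  rw [two_mul]
  nth_rewrite 2 [← Equiv.sum_comp φ]
  rw [← sum_add_distrib]
  have : ∀ f : V → Bool, ((if (s ^^ f a) = (t ^^ f b) then (0 : ℝ) else 1) +
      if (s ^^ φ f a) = (t ^^ φ f b) then (0 : ℝ) else 1) = 1 := by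
    intro f
    have h1 : φ f a = !f a := by simp [φ, Function.Involutive.toPerm]
    have h2 : φ f b = f b := by simp [φ, Function.Involutive.toPerm, hab.symm]
    rw [h1, h2]
    cases s <;> cases t <;> cases f a <;> cases f b <;> simp
  simp [this]

open Classical in
/-- If the vertices are partitioned into the fibres of `ρ`, and `side` properly 2-colours each of
the graphs induced by the parts, then some cut contains all edges inside the parts and
half of the weight of the other edges. -/
theorem sum_partition_le_mac (G : SimpleGraph V) (w : Sym2 V → ℝ) {R : Type*} [Fintype R]
    (ρ : V → R) (side : V → Bool) (h : ∀ u v, G.Adj u v → ρ u = ρ v → side u ≠ side v) :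
    (∑ e ∈ G.edgeFinset, w e * if (e.map ρ).IsDiag then 2 else 1) ≤ 2 * mac G w := by
  have hsum : ∑ f : R → Bool, (∑ e ∈ G.edgeFinset,
      w e * if (e.map fun v => side v ^^ f (ρ v)).IsDiag then 0 else 1) ≤
      ∑ f : R → Bool, mac G w := sum_le_sum fun f _ => sum_le_mac G w _
  have hcard : (0 : ℝ) < Fintype.card (R → Bool) := by exact_mod_cast Fintype.card_pos
  rw [sum_comm, sum_const, nsmul_eq_mul, card_univ] at hsum
  have key : ∑ e ∈ G.edgeFinset, ∑ f : R → Bool,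
      (w e * if (e.map fun v => side v ^^ f (ρ v)).IsDiag then 0 else 1) =
      (Fintype.card (R → Bool) / 2) *
        ∑ e ∈ G.edgeFinset, w e * if (e.map ρ).IsDiag then 2 else 1 := by
    rw [mul_sum]
    refine sum_congr rfl fun e he => ?_
    rw [← mul_sum, mul_left_comm]
    congr 1
    induction e with
    | h u v =>
      rw [SimpleGraph.mem_edgeFinset, SimpleGraph.mem_edgeSet] at he
      simp only [Sym2.map_mk, Sym2.mk_isDiag_iff]
      by_cases hρ : ρ u = ρ v
      · have := h u v he hρ
        simp [hρ, this]
      · have := two_mul_card_flips hρ (side u) (side v)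
        simp only [hρ, if_false]
        linarith
  rw [key] at hsum
  have : (Fintype.card (R → Bool) : ℝ) * ((∑ e ∈ G.edgeFinset, w e *
      if (e.map ρ).IsDiag then 2 else 1) / 2) ≤ Fintype.card (R → Bool) * mac G w := by linarith
  have := le_of_mul_le_mul_left this hcard
  linarith

end Cuts

/-! ### Directed colourings and the averaging of cuts. -/

section Labels

variable {V : Type*} {G : SimpleGraph V}

/-- The colour following (`true`) or preceding (`false`) the colour `a` in cyclic order. -/
def shift (b : Bool) (a : ZMod 3) : ZMod 3 := if b then a + 1 else a - 1

/-- A proper colouring `c` with a direction `ε` at each vertex such that every vertex has at most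
one neighbour of the colour that its direction points to. -/
structure IsDirectedColoring (G : SimpleGraph V) (c : V → ZMod 3) (ε : V → Bool) : Prop where
  proper : ∀ u v, G.Adj u v → c u ≠ c v
  unique : ∀ v x y, G.Adj v x → G.Adj v y →
    c x = shift (ε v) (c v) → c y = shift (ε v) (c v) → x = y

theorem IsDirectedColoring.sub {c : V → ZMod 3} {ε : V → Bool} (h : IsDirectedColoring G c ε)
    (k : ZMod 3) : IsDirectedColoring G (fun v => c v - k) ε where
  proper u v huv h' := h.proper u v huv (sub_left_injective h')
  unique v x y hx hy h1 h2 := by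
    have e : shift (ε v) (c v - k) = shift (ε v) (c v) - k := by
      unfold shift; split <;> ring
    rw [e] at h1 h2
    exact h.unique v x y hx hy (sub_left_injective h1) (sub_left_injective h2)

/-- If both other colours occurred twice around `v`, it would have four neighbours. -/
theorem exists_directedColoring {N : V → Finset V} (hN : ∀ v u, u ∈ N v ↔ G.Adj v u)
    (hdeg : ∀ v, (N v).card ≤ 3) {c : V → ZMod 3} (hc : ∀ u v, G.Adj u v → c u ≠ c v) :
    ∃ ε : V → Bool, IsDirectedColoring G c ε := by
  have : ∀ v, ∃ b : Bool, ((N v).filter fun u => c u = shift b (c v)).card ≤ 1 := by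
    intro v
    by_contra! h
    have h1 := h true
    have h2 := h false
    classical
    have hd : Disjoint ((N v).filter fun u => c u = shift true (c v))
        ((N v).filter fun u => c u = shift false (c v)) := by
      rw [disjoint_filter]
      intro u _ h3 h4
      rw [h3] at h4
      revert h4
      generalize c v = a
      revert a
      decide
    have h3 := (card_union_of_disjoint hd).symm.trans_le
      (card_le_card (union_subset (filter_subset _ _) (filter_subset _ _)))
    have := hdeg v
    omega
  choose ε hε using this
  refine ⟨ε, hc, fun v x y hx hy h1 h2 => ?_⟩
  exact card_le_one.1 (hε v) x (by simp [hN, hx, h1]) y (by simp [hN, hy, h2])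

namespace IsDirectedColoring

variable {c : V → ZMod 3} {ε : V → Bool}

open Classical in
/-- The neighbour of `v` of the colour that the direction of `v` points to; `v` if there is none. -/
noncomputable def next (G : SimpleGraph V) (c : V → ZMod 3) (ε : V → Bool) (v : V) : V :=
  if h : ∃ x, G.Adj v x ∧ c x = shift (ε v) (c v) then h.choose else v

theorem next_eq (h : IsDirectedColoring G c ε) {v x : V} (hvx : G.Adj v x)
    (hx : c x = shift (ε v) (c v)) : next G c ε v = x := by
  have h' : ∃ x, G.Adj v x ∧ c x = shift (ε v) (c v) := ⟨x, hvx, hx⟩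
  rw [next, dif_pos h']
  exact h.unique v _ _ h'.choose_spec.1 hvx h'.choose_spec.2 hx

theorem next_cases (G : SimpleGraph V) (c : V → ZMod 3) (ε : V → Bool) (v : V) :
    next G c ε v = v ∨ G.Adj v (next G c ε v) ∧ c (next G c ε v) = shift (ε v) (c v) := by
  by_cases h' : ∃ x, G.Adj v x ∧ c x = shift (ε v) (c v)
  · rw [next, dif_pos h']
    exact Or.inr h'.choose_spec
  · rw [next, dif_neg h']
    exact Or.inl rfl

/-- The representative of the part containing `v`. -/
noncomputable def root (G : SimpleGraph V) (c : V → ZMod 3) (ε : V → Bool) (v : V) : V :=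
  if c v = 0 then v
  -- Here `v` points away from colour 0. If its target has the same direction, that target points on
  -- to colour 0 and `v` has depth two; otherwise the two point at each other and form a part,
  -- represented by the end with direction `true`.
  else if c v = shift (ε v) 0 then
    if ε (next G c ε v) = ε v then next G c ε (next G c ε v)
    else if ε v then v else next G c ε v
  else next G c ε v

/-- A 2-colouring that is proper on every part. -/
noncomputable def side (G : SimpleGraph V) (c : V → ZMod 3) (ε : V → Bool) (v : V) : Bool :=
  if c v = 0 then true
  else if c v = shift (ε v) 0 then ε v || (ε (next G c ε v) == ε v)
  else false

theorem zmod_three_cases (a : ZMod 3) : a = 0 ∨ a = 1 ∨ a = 2 := by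
  revert a; decide

theorem shift_values : shift true 0 = 1 ∧ shift true 1 = 2 ∧ shift true 2 = 0 ∧ shift false 0 = 2 ∧
    shift false 1 = 0 ∧ shift false 2 = 1 ∧ (0 : ZMod 3) ≠ 1 ∧ (0 : ZMod 3) ≠ 2 ∧
    (1 : ZMod 3) ≠ 2 := by
  decide

/-- Inside a tree, an edge between two children of the root, or from the root to depth two, would
close a triangle. Adjacent vertices of depth two would point at each other and form their own part.
-/
theorem side_ne_of_root_eq (h : IsDirectedColoring G c ε)
    (htri : ∀ u v x, G.Adj u v → G.Adj v x → ¬ G.Adj u x) {u v : V} (huv : G.Adj u v)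
    (hroot : root G c ε u = root G c ε v) : side G c ε u ≠ side G c ε v := by
  have hne := h.proper u v huv
  have hnu := next_cases G c ε u
  have hnv := next_cases G c ε v
  have hnnu := next_cases G c ε (next G c ε u)
  have hnnv := next_cases G c ε (next G c ε v)
  have huv' := @next_eq _ _ _ _ h u v huv
  have hvu' := @next_eq _ _ _ _ h v u huv.symm
  have t1 := htri u v (next G c ε u) huv
  have t2 := htri v u (next G c ε v) huv.symm
  have hs := huv.symm
  have t3 := htri u (next G c ε u) v
  have t4 := htri v (next G c ε v) u
  have s1 := G.adj_comm v (next G c ε u)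
  have s2 := G.adj_comm u (next G c ε v)
  obtain ⟨e1, e2, e3, e4, e5, e6, e7, e8, e9⟩ := shift_values
  unfold root at hroot
  unfold side
  generalize next G c ε (next G c ε u) = uu at *
  generalize next G c ε (next G c ε v) = vv at *
  generalize next G c ε u = u1 at *
  generalize next G c ε v = v1 at *
  clear htri h
  rcases zmod_three_cases (c u) with hu | hu | hu <;>
  rcases zmod_three_cases (c v) with hv | hv | hv <;>
  rcases hεu : ε u <;> rcases hεv : ε v <;> grind

/-- Only arcs out of colour 0 are dropped; a mutual edge survives even then, through its other end.
-/
theorem root_eq_of_adj (h : IsDirectedColoring G c ε) {u v : V} (huv : G.Adj u v)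
    (hv : c v = shift (ε u) (c u)) (huv' : ε u = ε v → c u ≠ 0)
    (hvu : ε u ≠ ε v → c u = shift (ε v) (c v)) : root G c ε u = root G c ε v := by
  have hu1 := h.next_eq huv hv
  have hv1 := @next_eq _ _ _ _ h v u huv.symm
  obtain ⟨e1, e2, e3, e4, e5, e6, e7, e8, e9⟩ := shift_values
  unfold root
  rw [hu1]
  generalize next G c ε v = v1 at *
  rcases zmod_three_cases (c u) with hu | hu | hu <;>
  rcases hεu : ε u <;> rcases hεv : ε v <;> grind

/-- The side of a vertex of colour `a` and direction `s` in the cut that separates the two colours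
other than `k`, where vertices of colour `k` join the colour that they point to. -/
def cutSide (k a : ZMod 3) (s : Bool) : Bool := (if a = k then shift s a else a) == k + 1

/-- The edge is cut when `k` is the third colour; when `k` is the colour of an end, it is cut unless
that end points to the other. -/
theorem sum_cutSide : ∀ (a b : ZMod 3) (s t : Bool), a ≠ b →
    ∑ k : ZMod 3, (if cutSide k a s = cutSide k b t then 0 else 1) =
      if s = t then 2 else if b = shift s a then 1 else 3 := by
  decide

theorem shift_trichotomy : ∀ (a b : ZMod 3) (s t : Bool), a ≠ b →
    (s = t → b = shift s a ∨ a = shift t b) ∧ (s ≠ t → b = shift s a → a = shift t b) := by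
  decide

theorem shift_sub (s : Bool) (a k : ZMod 3) : shift s (a - k) = shift s a - k := by
  unfold shift; split <;> ring

-- A one-way arc leaves its part only when `k` is the colour of its tail, giving 1 + 2 + 2; a mutual
-- edge never does.
open Classical in
theorem le_sum_root_eq (h : IsDirectedColoring G c ε) {u v : V} (huv : G.Adj u v) :
    (if ε u = ε v then 5 else if c v = shift (ε u) (c u) then 6 else 3) ≤
    ∑ k : ZMod 3, (if root G (fun v => c v - k) ε u = root G (fun v => c v - k) ε v
      then 2 else 1) := by
  obtain ⟨h1, h2⟩ := shift_trichotomy (c u) (c v) (ε u) (ε v) (h.proper u v huv)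
  have hsum : ∀ k₀ : ZMod 3, ∑ k : ZMod 3, (if k = k₀ then 1 else 2) = 5 := by decide
  split_ifs with hε hD
  · rcases h1 hε with hD | hD
    · rw [← hsum (c u)]
      refine sum_le_sum fun k _ => ?_
      by_cases hk : k = c u
      · rw [if_pos hk]
        split_ifs <;> simp
      · rw [if_neg hk, if_pos]
        exact (h.sub k).root_eq_of_adj huv (by rw [shift_sub, hD])
          (fun _ h0 => hk (sub_eq_zero.1 h0).symm) (fun h0 => absurd hε h0)
    · rw [← hsum (c v)]
      refine sum_le_sum fun k _ => ?_
      by_cases hk : k = c v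
      · rw [if_pos hk]
        split_ifs <;> simp
      · rw [if_neg hk, if_pos]
        exact ((h.sub k).root_eq_of_adj huv.symm (by rw [shift_sub, hD])
          (fun _ h0 => hk (sub_eq_zero.1 h0).symm) (fun h0 => absurd hε.symm h0)).symm
  · refine le_of_eq_of_le ?_ (sum_le_sum (f := fun _ => 2) fun k _ => ?_)
    · simp [ZMod.card]
    · rw [if_pos]
      exact (h.sub k).root_eq_of_adj huv (by rw [shift_sub, hD])
        (fun h0 => absurd h0 hε) (fun _ => by rw [shift_sub, ← h2 hε hD])
  · refine le_of_eq_of_le ?_ (sum_le_sum (f := fun _ => 1) fun k _ => ?_)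
    · simp [ZMod.card]
    · split_ifs <;> simp

open Classical in
theorem eight_elevenths_le_mac [Fintype V] (h : IsDirectedColoring G c ε)
    (htri : ∀ u v x, G.Adj u v → G.Adj v x → ¬ G.Adj u x) (w : Sym2 V → ℝ)
    (hw : ∀ e ∈ G.edgeSet, 0 ≤ w e) : 8 / 11 * weight G w ≤ mac G w := by
  have hε := sum_le_mac G w ε
  have hcut := sum_le_sum fun (k : ZMod 3) (_ : k ∈ univ) =>
    sum_le_mac G w fun v => cutSide k (c v) (ε v)
  have hpart := sum_le_sum fun (k : ZMod 3) (_ : k ∈ univ) =>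
    sum_partition_le_mac G w (root G (fun v => c v - k) ε) (side G (fun v => c v - k) ε)
      fun u v huv => (h.sub k).side_ne_of_root_eq htri huv
  simp only [sum_const, card_univ, ZMod.card, nsmul_eq_mul, Nat.cast_ofNat] at hcut hpart
  rw [sum_comm] at hcut hpart
  -- The coefficients equalise the three edge types: 6 + 0 + 10 one-way, 3 + 1 + 12 mutual, 9 + 1 +
  -- 6 otherwise.
  have key : ∑ e ∈ G.edgeFinset, 16 * w e ≤
      3 * (∑ e ∈ G.edgeFinset, ∑ k : ZMod 3,
        w e * if (e.map fun v => cutSide k (c v) (ε v)).IsDiag then 0 else 1) +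
      (∑ e ∈ G.edgeFinset, w e * if (e.map ε).IsDiag then 0 else 1) +
      2 * ∑ e ∈ G.edgeFinset, ∑ k : ZMod 3,
        w e * if (e.map (root G (fun v => c v - k) ε)).IsDiag then 2 else 1 := by
    rw [mul_sum, mul_sum, ← sum_add_distrib, ← sum_add_distrib]
    refine sum_le_sum fun e he => ?_
    rw [← mul_sum, ← mul_sum, mul_left_comm, mul_left_comm 2, ← mul_add, ← mul_add, mul_comm 16]
    rw [SimpleGraph.mem_edgeFinset] at he
    refine mul_le_mul_of_nonneg_left ?_ (hw e he)
    induction e with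
    | h u v =>
      have h1 := sum_cutSide (c u) (c v) (ε u) (ε v) (h.proper u v he)
      have h2 := h.le_sum_root_eq (u := u) (v := v) he
      have h3 : 16 ≤ 3 * (∑ k : ZMod 3,
            if cutSide k (c u) (ε u) = cutSide k (c v) (ε v) then 0 else 1) +
          (if ε u = ε v then 0 else 1) +
          2 * ∑ k : ZMod 3, (if root G (fun v => c v - k) ε u = root G (fun v => c v - k) ε v
            then 2 else 1) := by
        rw [h1]
        by_cases h4 : ε u = ε v <;> by_cases h5 : c v = shift (ε u) (c u) <;>
          simp only [h4, h5, if_true, if_false] at h2 ⊢ <;> omega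
      simp only [Sym2.map_mk, Sym2.mk_isDiag_iff]
      exact_mod_cast h3
  rw [← mul_sum] at key
  have : weight G w = ∑ e ∈ G.edgeFinset, w e := by
    unfold weight
    congr!
  rw [this]
  linarith

end IsDirectedColoring

end Labels

end WeightedCut

theorem theorem5p1 {V : Type*} [Fintype V] (G : SimpleGraph V) [DecidableRel G.Adj]
    (w : Sym2 V → ℝ) (hw : ∀ e ∈ G.edgeSet, 0 ≤ w e)
    (htriangle : G.CliqueFree 3) (hdeg : G.maxDegree ≤ 3) :
    (8 / 11 : ℝ) * WeightedCut.weight G w ≤ WeightedCut.mac G w := by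
  classical
  have htri : ∀ u v x, G.Adj u v → G.Adj v x → ¬ G.Adj u x := fun u v x huv hvx hux =>
    htriangle {u, v, x} (SimpleGraph.is3Clique_triple_iff.2 ⟨huv, hux, hvx⟩)
  have hN : ∀ v u, u ∈ G.neighborFinset v ↔ G.Adj v u := fun v u => G.mem_neighborFinset v u
  have hcard : ∀ v, (G.neighborFinset v).card ≤ 3 := fun v => (G.degree_le_maxDegree v).trans hdeg
  obtain ⟨c, hc⟩ := WeightedCut.exists_properOn hN hcard htri Finset.univ
  obtain ⟨ε, hε⟩ := WeightedCut.exists_directedColoring hN hcard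
    fun u v huv => hc u (Finset.mem_univ u) v (Finset.mem_univ v) huv
  exact hε.eight_elevenths_le_mac htri w hw
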